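/- Let $X$ be a nonzero finite-dimensional complex Hilbert space (for instance $X=\mathbb C^n$ with $n\ge 1$), and write $\mathrm{End}(X)$ for the space of linear operators on $X$, with the Hilbert--Schmidt inner product $\langle a,b\rangle=\mathrm{Tr}(a^\dagger b)$. In a dagger compact category, a classical structure on an object $X$ is a morphism $\delta\colon X\to X\otimes X$ with $(\mathrm{id}\otimes\delta^\dagger)\circ(\delta\otimes\mathrm{id})=\delta\circ\delta^\dagger=(\delta^\dagger\otimes\mathrm{id})\circ(\mathrm{id}\otimes\delta)$, $\delta^\dagger\circ\delta=\mathrm{id}$ and $\sigma\circ\delta=\delta$, where $\sigma$ is the swap. In $\mathbf{fdHilb}$, morphisms are linear maps between finite-dimensional complex Hilbert spaces and the dagger is the adjoint. In $\mathrm{CPM}(\mathbf{fdHilb})$, the objects are the same, the morphisms $X\to Y$ are the completely positive maps $\mathrm{End}(X)\to\mathrm{End}(Y)$, that is, the maps $\rho\mapsto\mathrm{Tr}_Z(f\rho f^\dagger)$ for a finite-dimensional Hilbert space $Z$ (the ancilla) and a linear map $f\colon X\to Z\otimes Y$ (a Kraus decomposition), the dagger is the adjoint for the Hilbert--Schmidt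 inner products, and the tensor product of $\Phi$ and $\Psi$ is determined by $a\otimes b\mapsto\Phi(a)\otimes\Psi(b)$; associators and swaps act on operators by conjugation. Let $\delta\colon\mathrm{End}(X)\to\mathrm{End}(X\otimes X)$ be a classical structure on $X$ in $\mathrm{CPM}(\mathbf{fdHilb})$. Call $\alpha\in\mathrm{End}(X)$ copyable if $\delta(\alpha)=\alpha\otimes\alpha$ (so $0$ is copyable). Then the following are equivalent: (a) $\delta$ is canonical: there is a classical structure $g\colon X\to X\otimes X$ in $\mathbf{fdHilb}$ with $\delta(\rho)=g\rho g^\dagger$ for all $\rho$; (b) $\delta$ preserves pure states: it maps every $|\psi\rangle\langle\psi|$ with $\|\psi\|=1$ to some $|\varphi\rangle\langle\varphi|$ with $\|\varphi\|=1$; (c) $\delta$ is trace-preserving: $\mathrm{Tr}(\delta(\rho))=\mathrm{Tr}(\rho)$ for all $\rho$; (d) $\delta^\dagger$ is unital: $\delta^\dagger(\mathrm{id}_{X\otimes X})=\mathrm{id}_X$; (e) $\delta^\dagger(\mathrm{id}_{X\otimes X})\le\mathrm{id}_X$; (f) $\delta$ is trace-nonincreasing: $\mathrm{Tr}(\delta(\rho))\le\mathrm{Tr}(\rho)$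 for all positive semidefinite $\rho$; (g) $\delta^\dagger(\mathrm{id}_{X\otimes X})$ has operator norm at most $1$; (h) $\mathrm{id}_X=\sum_{\alpha\in A}\alpha$ for some finite set $A$ of copyables; (i) $\mathrm{Tr}(\alpha)=1$ for every nonzero positive semidefinite copyable $\alpha$; (j) $\mathrm{rank}(\alpha)=1$ for every nonzero copyable $\alpha$; (k) if $\alpha$ is copyable, then so is $\alpha^\dagger\alpha$; (l) if $\alpha$ and $\beta$ are copyable, then so is $\alpha\beta$; (m) $\delta(\mathrm{id}_X)$ is idempotent; (n) the ancilla in a minimal Kraus decomposition of $\delta$ is one-dimensional: the least dimension of an ancilla in a Kraus decomposition of $\delta$ is $1$. -/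

import Mathlib

open scoped TensorProduct

namespace FdHilb

section Classical

variable {X : Type*} [NormedAddCommGroup X] [InnerProductSpace ℂ X] [FiniteDimensional ℂ X]

/-- A classical structure on a finite-dimensional Hilbert space `X`, in the dagger compact category
of finite-dimensional Hilbert spaces: a linear map `g : X → X ⊗ X` with
`(id ⊗ g†) ∘ (g ⊗ id) = g ∘ g† = (g† ⊗ id) ∘ (id ⊗ g)`, `g† ∘ g = id` and `swap ∘ g = g`
(associators written out). -/
structure IsClassicalStructure (g : X →ₗ[ℂ] X ⊗[ℂ] X) : Prop where
  frobenius_left :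
    TensorProduct.map (LinearMap.id : X →ₗ[ℂ] X) (LinearMap.adjoint g)
      ∘ₗ (TensorProduct.assoc ℂ X X X).toLinearMap
      ∘ₗ TensorProduct.map g (LinearMap.id : X →ₗ[ℂ] X) = g ∘ₗ LinearMap.adjoint g
  frobenius_right :
    TensorProduct.map (LinearMap.adjoint g) (LinearMap.id : X →ₗ[ℂ] X)
      ∘ₗ (TensorProduct.assoc ℂ X X X).symm.toLinearMap
      ∘ₗ TensorProduct.map (LinearMap.id : X →ₗ[ℂ] X) g = g ∘ₗ LinearMap.adjoint g
  special : LinearMap.adjoint g ∘ₗ g = LinearMap.id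
  commutative : (TensorProduct.comm ℂ X X).toLinearMap ∘ₗ g = g

end Classical

end FdHilb

/-! Morphisms `X → Y` of the category of completely positive maps are represented by their images
under the identification of `X* ⊗ X` with the space of operators `X →ₗ[ℂ] X`, in which
`⟨φ| ⊗ |ψ⟩` is `|ψ⟩⟨φ|`; they are linear maps `(X →ₗ[ℂ] X) →ₗ[ℂ] (Y →ₗ[ℂ] Y)`. -/
namespace CPM

section HilbertSchmidt

variable (X : Type*) [NormedAddCommGroup X] [InnerProductSpace ℂ X] [FiniteDimensional ℂ X]

theorem trace_adjoint_comp_eq_sum (a b : X →ₗ[ℂ] X) :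
    LinearMap.trace ℂ X (LinearMap.adjoint a ∘ₗ b)
      = ∑ i, inner ℂ (a (stdOrthonormalBasis ℂ X i)) (b (stdOrthonormalBasis ℂ X i)) := by
  rw [LinearMap.trace_eq_sum_inner _ (stdOrthonormalBasis ℂ X)]
  simp [LinearMap.adjoint_inner_right]

/-- The Hilbert-Schmidt inner product `⟨a, b⟩ = Tr(a† b)` on the operators of `X`. -/
@[reducible]
noncomputable def hsCore : InnerProductSpace.Core ℂ (X →ₗ[ℂ] X) where
  inner a b := LinearMap.trace ℂ X (LinearMap.adjoint a ∘ₗ b)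
  conj_inner_symm a b := by
    simp only [trace_adjoint_comp_eq_sum, map_sum, inner_conj_symm]
  re_inner_nonneg a := by
    simp only [trace_adjoint_comp_eq_sum, map_sum]
    exact Finset.sum_nonneg fun i _ => inner_self_nonneg
  add_left a b c := by rw [map_add, LinearMap.add_comp, map_add]
  smul_left a b r := by
    rw [map_smulₛₗ, LinearMap.smul_comp, map_smul, smul_eq_mul]
  definite a h := by
    rw [trace_adjoint_comp_eq_sum] at h
    have h' := congrArg (RCLike.re : ℂ → ℝ) h
    rw [map_sum, map_zero,
      Finset.sum_eq_zero_iff_of_nonneg (fun i _ => inner_self_nonneg (𝕜 := ℂ))] at h'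
    refine (stdOrthonormalBasis ℂ X).toBasis.ext fun i => ?_
    have h1 := h' i (Finset.mem_univ i)
    have h2 : a (stdOrthonormalBasis ℂ X i) = 0 := by
      rw [← inner_self_eq_zero (𝕜 := ℂ), ← inner_self_ofReal_re (𝕜 := ℂ)]
      exact congrArg (RCLike.ofReal : ℝ → ℂ) h1 |>.trans RCLike.ofReal_zero
    simpa using h2

end HilbertSchmidt

section Morphisms

variable {X Z Y X' Y' : Type*}
  [NormedAddCommGroup X] [InnerProductSpace ℂ X] [FiniteDimensional ℂ X]
  [NormedAddCommGroup Y] [InnerProductSpace ℂ Y] [FiniteDimensional ℂ Y]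
  [NormedAddCommGroup Z] [InnerProductSpace ℂ Z] [FiniteDimensional ℂ Z]
  [NormedAddCommGroup X'] [InnerProductSpace ℂ X'] [FiniteDimensional ℂ X']
  [NormedAddCommGroup Y'] [InnerProductSpace ℂ Y'] [FiniteDimensional ℂ Y']

/-- The dagger `Φ†`: the Hilbert space adjoint of `Φ` for the Hilbert-Schmidt inner products. -/
noncomputable def dagger (Φ : (X →ₗ[ℂ] X) →ₗ[ℂ] (Y →ₗ[ℂ] Y)) :
    (Y →ₗ[ℂ] Y) →ₗ[ℂ] (X →ₗ[ℂ] X) :=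
  letI : NormedAddCommGroup (X →ₗ[ℂ] X) := (hsCore X).toNormedAddCommGroup
  letI : InnerProductSpace ℂ (X →ₗ[ℂ] X) := InnerProductSpace.ofCore (hsCore X).toCore
  letI : NormedAddCommGroup (Y →ₗ[ℂ] Y) := (hsCore Y).toNormedAddCommGroup
  letI : InnerProductSpace ℂ (Y →ₗ[ℂ] Y) := InnerProductSpace.ofCore (hsCore Y).toCore
  LinearMap.adjoint Φ

/-- The defining property of the dagger, `Tr(b† Φ(a)) = Tr(Φ†(b)† a)`. -/
theorem trace_dagger (Φ : (X →ₗ[ℂ] X) →ₗ[ℂ] (Y →ₗ[ℂ] Y)) (a : X →ₗ[ℂ] X) (b : Y →ₗ[ℂ] Y) :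
    LinearMap.trace ℂ X (LinearMap.adjoint (dagger Φ b) ∘ₗ a)
      = LinearMap.trace ℂ Y (LinearMap.adjoint b ∘ₗ Φ a) := by
  let : NormedAddCommGroup (X →ₗ[ℂ] X) := (hsCore X).toNormedAddCommGroup
  let : InnerProductSpace ℂ (X →ₗ[ℂ] X) := InnerProductSpace.ofCore (hsCore X).toCore
  let : NormedAddCommGroup (Y →ₗ[ℂ] Y) := (hsCore Y).toNormedAddCommGroup
  let : InnerProductSpace ℂ (Y →ₗ[ℂ] Y) := InnerProductSpace.ofCore (hsCore Y).toCore
  exact LinearMap.adjoint_inner_left Φ a b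

/-- The image `f_* ⊗ f` in completely positive maps of a linear map `f`, namely `ρ ↦ f ρ f†`. -/
noncomputable def induced (f : X →ₗ[ℂ] Y) : (X →ₗ[ℂ] X) →ₗ[ℂ] (Y →ₗ[ℂ] Y) where
  toFun ρ := f ∘ₗ ρ ∘ₗ LinearMap.adjoint f
  map_add' ρ σ := by rw [LinearMap.add_comp, LinearMap.comp_add]
  map_smul' c ρ := by rw [LinearMap.smul_comp, LinearMap.comp_smul, RingHom.id_apply]

variable (Z Y) in
/-- The partial trace over the first factor, the linear map with `a ⊗ b ↦ Tr(a) b`. -/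
noncomputable def partialTrace :
    ((Z ⊗[ℂ] Y) →ₗ[ℂ] (Z ⊗[ℂ] Y)) →ₗ[ℂ] (Y →ₗ[ℂ] Y) :=
  (TensorProduct.lid ℂ (Y →ₗ[ℂ] Y)).toLinearMap
    ∘ₗ TensorProduct.map (LinearMap.trace ℂ Z) LinearMap.id
    ∘ₗ (homTensorHomEquiv ℂ Z Y Z Y).symm.toLinearMap

/-- The completely positive map with Kraus morphism `f : X → Z ⊗ Y` and ancilla `Z`, that is
`(id ⊗ ε ⊗ id) ∘ (f_* ⊗ f)`. -/
noncomputable def ofKraus (f : X →ₗ[ℂ] Z ⊗[ℂ] Y) : (X →ₗ[ℂ] X) →ₗ[ℂ] (Y →ₗ[ℂ] Y) :=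
  partialTrace Z Y ∘ₗ induced f

/-- `Φ` has a Kraus morphism whose ancilla has dimension `k`. (Every finite-dimensional Hilbert
space is isometric to some `ℂ^k`.) -/
def HasKrausAncilla (Φ : (X →ₗ[ℂ] X) →ₗ[ℂ] (Y →ₗ[ℂ] Y)) (k : ℕ) : Prop :=
  ∃ f : X →ₗ[ℂ] EuclideanSpace ℂ (Fin k) ⊗[ℂ] Y, Φ = ofKraus f

/-- `Φ` is completely positive, that is, a morphism `X → Y` of the category: it has a Kraus
morphism. -/
def IsCompletelyPositive (Φ : (X →ₗ[ℂ] X) →ₗ[ℂ] (Y →ₗ[ℂ] Y)) : Prop :=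
  ∃ k : ℕ, HasKrausAncilla Φ k

/-- The tensor product of morphisms: `(Φ ⊗ Ψ)(a ⊗ b) = Φ(a) ⊗ Ψ(b)`, where the operators on
`X ⊗ Y` are identified with the tensor product of the operators on `X` and on `Y`. -/
noncomputable def tensor (Φ : (X →ₗ[ℂ] X) →ₗ[ℂ] (X' →ₗ[ℂ] X'))
    (Ψ : (Y →ₗ[ℂ] Y) →ₗ[ℂ] (Y' →ₗ[ℂ] Y')) :
    ((X ⊗[ℂ] Y) →ₗ[ℂ] (X ⊗[ℂ] Y)) →ₗ[ℂ] ((X' ⊗[ℂ] Y') →ₗ[ℂ] (X' ⊗[ℂ] Y')) :=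
  (homTensorHomEquiv ℂ X' Y' X' Y').toLinearMap
    ∘ₗ TensorProduct.map Φ Ψ
    ∘ₗ (homTensorHomEquiv ℂ X Y X Y).symm.toLinearMap

end Morphisms

section Classical

variable {X : Type*} [NormedAddCommGroup X] [InnerProductSpace ℂ X] [FiniteDimensional ℂ X]

/-- A classical structure on `X` in the dagger compact category of completely positive maps: a
completely positive map `δ : X → X ⊗ X` with
`(id ⊗ δ†) ∘ (δ ⊗ id) = δ ∘ δ† = (δ† ⊗ id) ∘ (id ⊗ δ)`, `δ† ∘ δ = id` and `swap ∘ δ = δ`.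
The associators and the swap of this category act on operators by conjugation. -/
structure IsClassicalStructure
    (δ : (X →ₗ[ℂ] X) →ₗ[ℂ] ((X ⊗[ℂ] X) →ₗ[ℂ] (X ⊗[ℂ] X))) : Prop where
  completelyPositive : IsCompletelyPositive δ
  frobenius_left :
    tensor (LinearMap.id : (X →ₗ[ℂ] X) →ₗ[ℂ] (X →ₗ[ℂ] X)) (dagger δ)
      ∘ₗ induced (TensorProduct.assoc ℂ X X X).toLinearMap
      ∘ₗ tensor δ (LinearMap.id : (X →ₗ[ℂ] X) →ₗ[ℂ] (X →ₗ[ℂ] X)) = δ ∘ₗ dagger δ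
  frobenius_right :
    tensor (dagger δ) (LinearMap.id : (X →ₗ[ℂ] X) →ₗ[ℂ] (X →ₗ[ℂ] X))
      ∘ₗ induced (TensorProduct.assoc ℂ X X X).symm.toLinearMap
      ∘ₗ tensor (LinearMap.id : (X →ₗ[ℂ] X) →ₗ[ℂ] (X →ₗ[ℂ] X)) δ = δ ∘ₗ dagger δ
  special : dagger δ ∘ₗ δ = LinearMap.id
  commutative : induced (TensorProduct.comm ℂ X X).toLinearMap ∘ₗ δ = δ

/-- `δ` is canonical: it is induced by a classical structure on the Hilbert space `X`. -/
def IsCanonical (δ : (X →ₗ[ℂ] X) →ₗ[ℂ] ((X ⊗[ℂ] X) →ₗ[ℂ] (X ⊗[ℂ] X))) : Prop :=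
  ∃ g : X →ₗ[ℂ] X ⊗[ℂ] X, FdHilb.IsClassicalStructure g ∧ δ = induced g

/-- A induced state `|ψ⟩⟨ψ|`, for a unit vector `ψ`. -/
def IsPureState (ρ : X →ₗ[ℂ] X) : Prop :=
  ∃ ψ : X, ‖ψ‖ = 1 ∧ ρ = (InnerProductSpace.rankOne ℂ ψ ψ).toLinearMap

/-- An operator `α` is copyable when `δ(α) = α ⊗ α`; the zero operator is copyable. -/
def IsCopyable (δ : (X →ₗ[ℂ] X) →ₗ[ℂ] ((X ⊗[ℂ] X) →ₗ[ℂ] (X ⊗[ℂ] X))) (α : X →ₗ[ℂ] X) : Prop :=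
  δ α = TensorProduct.map α α

end Classical

end CPM

/-! Every classical structure in completely positive maps is already canonical, so all fourteen
conditions simply hold, and their equivalence is a corollary.

Write `δ` as a sum of maps `ρ ↦ A ρ A†` over Kraus operators `A k`. Each law of `δ` equates two
Kraus sums, and two Kraus families of one map have the same linear span
(`mem_span_of_sum_induced_eq`). So the `A k` satisfy the Frobenius, special and commutative laws up
to linear combinations; this is `IsFrobeniusSpan`.

Partial traces then produce a vector `v` that is a two-sided unit, up to scalars `c k`, for all the
multiplications `(A k)†` at once (`IsFrobeniusSpan.exists_unit`). Evaluating the Frobenius law at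
`v` shows that `(A k)†` is determined by `c k`, so all the `A k` are proportional
(`IsFrobeniusSpan.exists_forall_eq_smul`) and `δ(ρ) = g ρ g†` for a single `g`. The laws for `δ`
give those for `g` up to scalars. Evaluation at `v`, and positivity for the special law, show that
the scalars are 1.

For canonical `δ`, most conditions follow from `g† g = id`. The exception is (h), which needs an
orthonormal basis of copyable vectors (`exists_orthonormalBasis_copyable`), found by diagonalising
the commuting multiplication operators of `g†` simultaneously. -/

namespace CPM

/-! ### Contraction with a vector of the first tensor factor -/

section Contraction

variable {Z Y W : Type*}
  [NormedAddCommGroup Y] [InnerProductSpace ℂ Y]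
  [NormedAddCommGroup Z] [InnerProductSpace ℂ Z]
  [NormedAddCommGroup W] [InnerProductSpace ℂ W]

variable (Y) in
/-- The contraction `⟨z| ⊗ id`. -/
noncomputable def contract (z : Z) : Z ⊗[ℂ] Y →ₗ[ℂ] Y :=
  TensorProduct.lift (LinearMap.toSpanSingleton ℂ (Y →ₗ[ℂ] Y) LinearMap.id ∘ₗ innerₛₗ ℂ z)

@[simp]
theorem contract_tmul (z a : Z) (y : Y) : contract Y z (a ⊗ₜ[ℂ] y) = inner ℂ z a • y := by
  simp [contract]

theorem inner_tmul_left (z : Z) (y : Y) (t : Z ⊗[ℂ] Y) :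
    inner ℂ (z ⊗ₜ[ℂ] y) t = inner ℂ y (contract Y z t) := by
  induction t with
  | zero => simp
  | add a b ha hb => simp [inner_add_right, ha, hb]
  | tmul a b => simp [TensorProduct.inner_tmul]

theorem contract_map (z : Z) (f : Y →ₗ[ℂ] W) (t : Z ⊗[ℂ] Y) :
    contract W z (TensorProduct.map LinearMap.id f t) = f (contract Y z t) := by
  induction t with
  | zero => simp
  | add a b ha hb => simp [ha, hb]
  | tmul a b => simp

theorem contract_assoc (z : Z) (t : Z ⊗[ℂ] Y) (w : W) :
    contract (Y ⊗[ℂ] W) z (TensorProduct.assoc ℂ Z Y W (t ⊗ₜ[ℂ] w)) =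
      contract Y z t ⊗ₜ[ℂ] w := by
  induction t with
  | zero => simp
  | add a b ha hb => simp [TensorProduct.add_tmul, ha, hb]
  | tmul a b => simp [TensorProduct.smul_tmul']

theorem sum_contract_tmul {ι : Type*} [Fintype ι] (b : OrthonormalBasis ι ℂ Z) (t : Z ⊗[ℂ] Y) :
    ∑ i, contract Y (b i) t ⊗ₜ[ℂ] b i = TensorProduct.comm ℂ Z Y t := by
  induction t with
  | zero => simp
  | add t s ht hs => simp [TensorProduct.add_tmul, Finset.sum_add_distrib, ht, hs]
  | tmul z y =>
    simp only [contract_tmul, TensorProduct.smul_tmul, ← TensorProduct.tmul_sum,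
      b.sum_repr', TensorProduct.comm_tmul]

variable [FiniteDimensional ℂ Y] [FiniteDimensional ℂ Z]

theorem adjoint_contract_apply (z : Z) (y : Y) :
    LinearMap.adjoint (contract Y z) y = z ⊗ₜ[ℂ] y := by
  refine ext_inner_right ℂ fun t => ?_
  rw [LinearMap.adjoint_inner_left, inner_tmul_left]

end Contraction

/-! ### Calculus of Kraus decompositions -/

section Kraus

variable {X Z Y W X' Y' : Type*}
  [NormedAddCommGroup X] [InnerProductSpace ℂ X] [FiniteDimensional ℂ X]
  [NormedAddCommGroup Y] [InnerProductSpace ℂ Y] [FiniteDimensional ℂ Y]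
  [NormedAddCommGroup Z] [InnerProductSpace ℂ Z] [FiniteDimensional ℂ Z]
  [NormedAddCommGroup W] [InnerProductSpace ℂ W] [FiniteDimensional ℂ W]
  [NormedAddCommGroup X'] [InnerProductSpace ℂ X'] [FiniteDimensional ℂ X']
  [NormedAddCommGroup Y'] [InnerProductSpace ℂ Y'] [FiniteDimensional ℂ Y']

theorem induced_apply (f : X →ₗ[ℂ] Y) (ρ : X →ₗ[ℂ] X) :
    induced f ρ = f ∘ₗ ρ ∘ₗ LinearMap.adjoint f := rfl

theorem induced_comp (g : Y →ₗ[ℂ] Z) (f : X →ₗ[ℂ] Y) :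
    induced (g ∘ₗ f) = induced g ∘ₗ induced f := by
  ext ρ x
  simp [induced_apply, LinearMap.adjoint_comp]

theorem induced_id : induced (LinearMap.id : X →ₗ[ℂ] X) = LinearMap.id := by
  ext ρ x
  simp [induced_apply]

theorem induced_smul (c : ℂ) (f : X →ₗ[ℂ] Y) :
    induced (c • f) = (c * starRingEnd ℂ c) • induced f := by
  ext ρ x
  simp [induced_apply, smul_smul, LinearMap.adjoint.map_smulₛₗ]

theorem dagger_induced (f : X →ₗ[ℂ] Y) : dagger (induced f) = induced (LinearMap.adjoint f) := by
  let : NormedAddCommGroup (X →ₗ[ℂ] X) := (hsCore X).toNormedAddCommGroup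
  let : InnerProductSpace ℂ (X →ₗ[ℂ] X) := InnerProductSpace.ofCore (hsCore X).toCore
  let : NormedAddCommGroup (Y →ₗ[ℂ] Y) := (hsCore Y).toNormedAddCommGroup
  let : InnerProductSpace ℂ (Y →ₗ[ℂ] Y) := InnerProductSpace.ofCore (hsCore Y).toCore
  refine ((LinearMap.eq_adjoint_iff _ _).2 fun b a => ?_).symm
  change LinearMap.trace ℂ X (LinearMap.adjoint (induced (LinearMap.adjoint f) b) ∘ₗ a)
      = LinearMap.trace ℂ Y (LinearMap.adjoint b ∘ₗ induced f a)
  simp only [induced_apply, LinearMap.adjoint_comp, LinearMap.adjoint_adjoint]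
  rw [LinearMap.comp_assoc, LinearMap.comp_assoc, LinearMap.trace_comp_comm']
  simp only [LinearMap.comp_assoc]

theorem dagger_sum {ι : Type*} (s : Finset ι) (Φ : ι → (X →ₗ[ℂ] X) →ₗ[ℂ] (Y →ₗ[ℂ] Y)) :
    dagger (∑ i ∈ s, Φ i) = ∑ i ∈ s, dagger (Φ i) := by
  unfold dagger
  exact map_sum _ _ _

omit [FiniteDimensional ℂ X'] [FiniteDimensional ℂ Y'] in
theorem homTensorHomEquiv_symm_map (f : X →ₗ[ℂ] X') (g : Y →ₗ[ℂ] Y') :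
    (homTensorHomEquiv ℂ X Y X' Y').symm (TensorProduct.map f g) = f ⊗ₜ[ℂ] g := by
  rw [LinearEquiv.symm_apply_eq]
  simp

theorem tensor_map (Φ : (X →ₗ[ℂ] X) →ₗ[ℂ] (X' →ₗ[ℂ] X')) (Ψ : (Y →ₗ[ℂ] Y) →ₗ[ℂ] (Y' →ₗ[ℂ] Y'))
    (f : X →ₗ[ℂ] X) (g : Y →ₗ[ℂ] Y) :
    tensor Φ Ψ (TensorProduct.map f g) = TensorProduct.map (Φ f) (Ψ g) := by
  simp [tensor, homTensorHomEquiv_symm_map]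

theorem tensor_induced (f : X →ₗ[ℂ] X') (g : Y →ₗ[ℂ] Y') :
    tensor (induced f) (induced g) = induced (TensorProduct.map f g) := by
  refine LinearMap.ext fun ρ => ?_
  obtain ⟨t, rfl⟩ := (homTensorHomEquiv ℂ X Y X Y).surjective ρ
  induction t with
  | zero => simp
  | add a b ha hb => rw [map_add, map_add, map_add, ha, hb]
  | tmul a b =>
    simp [tensor_map, induced_apply, TensorProduct.adjoint_map, ← TensorProduct.map_comp]

theorem tensor_sum_left {ι : Type*} (s : Finset ι) (Φ : ι → (X →ₗ[ℂ] X) →ₗ[ℂ] (X' →ₗ[ℂ] X'))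
    (Ψ : (Y →ₗ[ℂ] Y) →ₗ[ℂ] (Y' →ₗ[ℂ] Y')) :
    tensor (∑ i ∈ s, Φ i) Ψ = ∑ i ∈ s, tensor (Φ i) Ψ := by
  have : TensorProduct.map (∑ i ∈ s, Φ i) Ψ = ∑ i ∈ s, TensorProduct.map (Φ i) Ψ := by
    ext : 4
    simp [TensorProduct.sum_tmul]
  refine LinearMap.ext fun ρ => ?_
  simp only [tensor, this, LinearMap.comp_apply, LinearMap.sum_apply, map_sum]

theorem tensor_sum_right {ι : Type*} (s : Finset ι) (Φ : (X →ₗ[ℂ] X) →ₗ[ℂ] (X' →ₗ[ℂ] X'))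
    (Ψ : ι → (Y →ₗ[ℂ] Y) →ₗ[ℂ] (Y' →ₗ[ℂ] Y')) :
    tensor Φ (∑ i ∈ s, Ψ i) = ∑ i ∈ s, tensor Φ (Ψ i) := by
  have : TensorProduct.map Φ (∑ i ∈ s, Ψ i) = ∑ i ∈ s, TensorProduct.map Φ (Ψ i) := by
    ext : 4
    simp [TensorProduct.tmul_sum]
  refine LinearMap.ext fun ρ => ?_
  simp only [tensor, this, LinearMap.comp_apply, LinearMap.sum_apply, map_sum]

theorem partialTrace_apply {ι : Type*} [Fintype ι] (b : OrthonormalBasis ι ℂ Z)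
    (F : (Z ⊗[ℂ] Y) →ₗ[ℂ] (Z ⊗[ℂ] Y)) :
    partialTrace Z Y F = ∑ i, induced (contract Y (b i)) F := by
  obtain ⟨t, rfl⟩ := (homTensorHomEquiv ℂ Z Y Z Y).surjective F
  induction t with
  | zero => simp
  | add s t hs ht => simp only [map_add, hs, ht, Finset.sum_add_distrib]
  | tmul f g =>
    ext y
    simp [partialTrace, induced_apply, adjoint_contract_apply, homTensorHomEquiv_symm_map,
      LinearMap.trace_eq_sum_inner f b, Finset.sum_smul]

theorem ofKraus_eq_sum {ι : Type*} [Fintype ι] (b : OrthonormalBasis ι ℂ Z)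
    (f : X →ₗ[ℂ] Z ⊗[ℂ] Y) :
    ofKraus f = ∑ i, induced (contract Y (b i) ∘ₗ f) := by
  ext ρ : 1
  simp [ofKraus, partialTrace_apply b, induced_comp]

/-- Two Kraus families of the same completely positive map span the same operators. -/
theorem mem_span_of_sum_induced_eq {ι κ : Type*} [Fintype ι] [Fintype κ]
    {A : ι → X →ₗ[ℂ] Y} {B : κ → X →ₗ[ℂ] Y}
    (h : ∑ i, induced (A i) = ∑ j, induced (B j)) (i : ι) :
    A i ∈ Submodule.span ℂ (Set.range B) := by
  by_contra hi
  -- Separate `A i` from the span by a functional `φ`. The sum of `‖φ (A i)‖ ^ 2` over a Kraus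
  -- family depends only on the map it defines, and for `B` it vanishes.
  obtain ⟨φ, hφi, hφ⟩ := Submodule.exists_le_ker_of_notMem hi
  let b := stdOrthonormalBasis ℂ X
  -- Riesz vectors: `c a` represents the functional `y ↦ φ(|y⟩⟨b a|)` on `Y`.
  let c : Fin (Module.finrank ℂ X) → Y := fun a => (InnerProductSpace.toDual ℂ Y).symm
    (LinearMap.toContinuousLinearMap
      (φ ∘ₗ LinearMap.smulRightₗ (innerₛₗ ℂ (b a))))
  have hc (f : X →ₗ[ℂ] Y) : φ f = ∑ a, inner ℂ (c a) (f (b a)) := by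
    have : f = ∑ a, LinearMap.smulRight (innerₛₗ ℂ (b a)) (f (b a)) := by
      ext x
      conv_lhs => rw [← b.sum_repr' x]
      simp
    conv_lhs => rw [this]
    simp [c, map_sum]
  -- `‖φ f‖ ^ 2` is quadratic in `f` but linear in `induced f`, hence additive over Kraus sums.
  have key (f : X →ₗ[ℂ] Y) : ((‖φ f‖ ^ 2 : ℝ) : ℂ) =
      ∑ a, ∑ a', inner ℂ (c a)
        (induced f (LinearMap.smulRight (innerₛₗ ℂ (b a')) (b a)) (c a')) := by
    rw [Complex.ofReal_pow, ← Complex.mul_conj', hc, map_sum, Finset.sum_mul_sum]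
    refine Finset.sum_congr rfl fun a _ => Finset.sum_congr rfl fun a' _ => ?_
    rw [inner_conj_symm, induced_apply, LinearMap.comp_apply, LinearMap.comp_apply,
      LinearMap.smulRight_apply, map_smul, inner_smul_right, innerₛₗ_apply_apply,
      LinearMap.adjoint_inner_right, mul_comm]
  have hsum : ∑ i, ((‖φ (A i)‖ ^ 2 : ℝ) : ℂ) = ∑ j, ((‖φ (B j)‖ ^ 2 : ℝ) : ℂ) := by
    simp only [key]
    rw [Finset.sum_comm, Finset.sum_comm (s := (Finset.univ : Finset κ))]
    refine Finset.sum_congr rfl fun a _ => ?_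
    rw [Finset.sum_comm, Finset.sum_comm (s := (Finset.univ : Finset κ))]
    refine Finset.sum_congr rfl fun a' _ => ?_
    simp only [← inner_sum, ← LinearMap.sum_apply, h]
  have hB (j : κ) : φ (B j) = 0 := hφ (Submodule.subset_span ⟨j, rfl⟩)
  rw [← Complex.ofReal_sum, ← Complex.ofReal_sum, Complex.ofReal_inj] at hsum
  simp only [hB, norm_zero, ne_eq, OfNat.ofNat_ne_zero, not_false_eq_true, zero_pow,
    Finset.sum_const_zero] at hsum
  rw [Finset.sum_eq_zero_iff_of_nonneg fun i _ => by positivity] at hsum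
  exact hφi (by simpa using hsum i (Finset.mem_univ i))

end Kraus

end CPM

namespace CPM

/-! ### Spans of Kraus operators: a common unit and proportionality -/

section KrausSpans

variable {X ι : Type*} [NormedAddCommGroup X] [InnerProductSpace ℂ X] [FiniteDimensional ℂ X]

/-- The left-hand side `(id ⊗ m) ∘ (d ⊗ id)` of the Frobenius law. -/
noncomputable def frobeniusComp (d : X →ₗ[ℂ] X ⊗[ℂ] X) (m : X ⊗[ℂ] X →ₗ[ℂ] X) :
    X ⊗[ℂ] X →ₗ[ℂ] X ⊗[ℂ] X :=
  TensorProduct.map LinearMap.id m ∘ₗ (TensorProduct.assoc ℂ X X X).toLinearMap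
    ∘ₗ TensorProduct.map d LinearMap.id

omit [FiniteDimensional ℂ X] in
theorem contract_frobeniusComp (d : X →ₗ[ℂ] X ⊗[ℂ] X) (m : X ⊗[ℂ] X →ₗ[ℂ] X) (z x y : X) :
    contract X z (frobeniusComp d m (x ⊗ₜ[ℂ] y)) = m (contract X z (d x) ⊗ₜ[ℂ] y) := by
  simp [frobeniusComp, contract_map, contract_assoc]

omit [FiniteDimensional ℂ X] in
theorem frobeniusComp_tmul_of_unit {m : X ⊗[ℂ] X →ₗ[ℂ] X} {v : X} {c : ℂ}
    (hm : ∀ y, m (y ⊗ₜ[ℂ] v) = c • y) (d : X →ₗ[ℂ] X ⊗[ℂ] X) (x : X) :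
    frobeniusComp d m (x ⊗ₜ[ℂ] v) = c • d x := by
  simp only [frobeniusComp, LinearMap.comp_apply, TensorProduct.map_tmul, LinearMap.id_apply,
    LinearEquiv.coe_coe]
  induction d x with
  | zero => simp
  | add s t hs ht => simp [TensorProduct.add_tmul, hs, ht]
  | tmul a b => simp [hm]

/-- The linear span of a family of operators satisfies the laws of a commutative special Frobenius
structure, up to linear combinations. -/
structure IsFrobeniusSpan (A : ι → X →ₗ[ℂ] X ⊗[ℂ] X) : Prop where
  frobenius_mem (j k : ι) : frobeniusComp (A j) (LinearMap.adjoint (A k)) ∈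
    Submodule.span ℂ (Set.range fun p : ι × ι => A p.1 ∘ₗ LinearMap.adjoint (A p.2))
  mem_frobenius (j k : ι) : A j ∘ₗ LinearMap.adjoint (A k) ∈
    Submodule.span ℂ (Set.range fun p : ι × ι => frobeniusComp (A p.1) (LinearMap.adjoint (A p.2)))
  special_mem (j k : ι) : LinearMap.adjoint (A j) ∘ₗ A k ∈
    Submodule.span ℂ {(LinearMap.id : X →ₗ[ℂ] X)}
  special_ne_zero : ∃ j k, LinearMap.adjoint (A j) ∘ₗ A k ≠ 0
  comm_mem (k : ι) : (TensorProduct.comm ℂ X X).toLinearMap ∘ₗ A k ∈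
    Submodule.span ℂ (Set.range A)
  mem_comm (k : ι) : LinearMap.adjoint (A k) ∘ₗ (TensorProduct.comm ℂ X X).toLinearMap ∈
    Submodule.span ℂ (Set.range fun k => LinearMap.adjoint (A k))

omit [FiniteDimensional ℂ X] in
theorem comm_comp_comm : (TensorProduct.comm ℂ X X).toLinearMap ∘ₗ
    (TensorProduct.comm ℂ X X).toLinearMap = LinearMap.id := by
  ext; simp

/-- Closing the first wire turns `d` into a vector, its partial trace, which `m` then multiplies
from the left. These vectors are the candidate units. -/
theorem partialTrace_frobeniusComp_apply (d : X →ₗ[ℂ] X ⊗[ℂ] X) (m : X ⊗[ℂ] X →ₗ[ℂ] X) (y : X) :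
    partialTrace X X (frobeniusComp d m) y =
      m ((∑ a, contract X (stdOrthonormalBasis ℂ X a) (d (stdOrthonormalBasis ℂ X a))) ⊗ₜ[ℂ] y) := by
  simp [partialTrace_apply (stdOrthonormalBasis ℂ X), induced_apply, adjoint_contract_apply,
    contract_frobeniusComp, TensorProduct.sum_tmul]

/-- With a swap inserted, closing the first wire straightens the loop into a composite of `d` with
`m`, to which the special law applies. -/
theorem partialTrace_frobeniusComp_comm (d : X →ₗ[ℂ] X ⊗[ℂ] X) (m : X ⊗[ℂ] X →ₗ[ℂ] X) :
    partialTrace X X (frobeniusComp d m ∘ₗ (TensorProduct.comm ℂ X X).toLinearMap) =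
      m ∘ₗ (TensorProduct.comm ℂ X X).toLinearMap ∘ₗ d := by
  ext y
  simp [partialTrace_apply (stdOrthonormalBasis ℂ X), induced_apply, adjoint_contract_apply,
    contract_frobeniusComp, ← map_sum, sum_contract_tmul]

theorem map_mem_of_mem_span {V V' : Type*} [AddCommGroup V] [Module ℂ V] [AddCommGroup V']
    [Module ℂ V'] (f : V →ₗ[ℂ] V') {s : Set V} {p : Submodule ℂ V'} (h : ∀ x ∈ s, f x ∈ p)
    {x : V} (hx : x ∈ Submodule.span ℂ s) : f x ∈ p :=
  (Submodule.span_le (p := p.comap f)).2 h hx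

namespace IsFrobeniusSpan

variable {A : ι → X →ₗ[ℂ] X ⊗[ℂ] X} (hA : IsFrobeniusSpan A)
include hA

theorem comp_mem_span_id {f : X ⊗[ℂ] X →ₗ[ℂ] X}
    (hf : f ∈ Submodule.span ℂ (Set.range fun k => LinearMap.adjoint (A k))) (j : ι) :
    f ∘ₗ A j ∈ Submodule.span ℂ {(LinearMap.id : X →ₗ[ℂ] X)} := by
  refine map_mem_of_mem_span (LinearMap.lcomp ℂ X (A j)) ?_ hf
  rintro _ ⟨k, rfl⟩
  exact hA.special_mem k j

theorem comp_comm_mem {B : X ⊗[ℂ] X →ₗ[ℂ] X ⊗[ℂ] X}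
    (hB : B ∈ Submodule.span ℂ
      (Set.range fun p : ι × ι => A p.1 ∘ₗ LinearMap.adjoint (A p.2))) :
    B ∘ₗ (TensorProduct.comm ℂ X X).toLinearMap ∈ Submodule.span ℂ
      (Set.range fun p : ι × ι => A p.1 ∘ₗ LinearMap.adjoint (A p.2)) := by
  refine map_mem_of_mem_span (LinearMap.lcomp ℂ _ (TensorProduct.comm ℂ X X).toLinearMap) ?_ hB
  rintro _ ⟨⟨j, k⟩, rfl⟩
  change A j ∘ₗ (LinearMap.adjoint (A k) ∘ₗ (TensorProduct.comm ℂ X X).toLinearMap) ∈ _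
  refine map_mem_of_mem_span (LinearMap.llcomp ℂ _ _ _ (A j)) ?_ (hA.mem_comm k)
  rintro _ ⟨l, rfl⟩
  exact Submodule.subset_span ⟨(j, l), rfl⟩

theorem span_eq :
    Submodule.span ℂ (Set.range fun p : ι × ι =>
      frobeniusComp (A p.1) (LinearMap.adjoint (A p.2))) =
    Submodule.span ℂ (Set.range fun p : ι × ι => A p.1 ∘ₗ LinearMap.adjoint (A p.2)) := by
  apply le_antisymm <;> rw [Submodule.span_le] <;> rintro _ ⟨⟨j, k⟩, rfl⟩
  exacts [hA.frobenius_mem j k, hA.mem_frobenius j k]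

/-- The span is stable under precomposition with the swap and is also spanned by Frobenius
composites. After one swap the partial trace becomes a combination of maps `A† σ A`, which are
scalar by the commutative and special laws; a second swap undoes the first. -/
theorem partialTrace_mem {B : X ⊗[ℂ] X →ₗ[ℂ] X ⊗[ℂ] X}
    (hB : B ∈ Submodule.span ℂ
      (Set.range fun p : ι × ι => A p.1 ∘ₗ LinearMap.adjoint (A p.2))) :
    partialTrace X X B ∈ Submodule.span ℂ {(LinearMap.id : X →ₗ[ℂ] X)} := by
  have key : ∀ C ∈ Submodule.span ℂ
      (Set.range fun p : ι × ι => A p.1 ∘ₗ LinearMap.adjoint (A p.2)),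
      partialTrace X X (C ∘ₗ (TensorProduct.comm ℂ X X).toLinearMap) ∈
        Submodule.span ℂ {(LinearMap.id : X →ₗ[ℂ] X)} := by
    intro C hC
    rw [← hA.span_eq] at hC
    refine map_mem_of_mem_span (partialTrace X X ∘ₗ
      LinearMap.lcomp ℂ _ (TensorProduct.comm ℂ X X).toLinearMap) ?_ hC
    rintro _ ⟨⟨j, k⟩, rfl⟩
    simp only [LinearMap.comp_apply, LinearMap.lcomp_apply', partialTrace_frobeniusComp_comm]
    exact hA.comp_mem_span_id (hA.mem_comm k) j
  have := key _ (hA.comp_comm_mem hB)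
  rwa [LinearMap.comp_assoc, comm_comp_comm, LinearMap.comp_id] at this

/-- The multiplications `A†` have a common two-sided unit, up to scalars. -/
theorem exists_unit : ∃ (v : X) (c : ι → ℂ), (∃ k, c k ≠ 0) ∧
    (∀ k y, LinearMap.adjoint (A k) (v ⊗ₜ[ℂ] y) = c k • y) ∧
    (∀ k y, LinearMap.adjoint (A k) (y ⊗ₜ[ℂ] v) = c k • y) := by
  -- Partial traces of the `A j`.
  let w : ι → X := fun j =>
    ∑ a, contract X (stdOrthonormalBasis ℂ X a) (A j (stdOrthonormalBasis ℂ X a))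
  have hw (j k : ι) : ∃ c : ℂ, ∀ y, LinearMap.adjoint (A k) (w j ⊗ₜ[ℂ] y) = c • y := by
    obtain ⟨c, hc⟩ := Submodule.mem_span_singleton.1
      (hA.partialTrace_mem (hA.frobenius_mem j k))
    refine ⟨c, fun y => ?_⟩
    rw [← partialTrace_frobeniusComp_apply, ← hc]
    simp
  choose c hc using hw
  -- If all the scalars vanished, partial traces would vanish on the whole span. Then every `A† σ A`
  -- would be zero, and so would every `A† A`, since `σ A` stays in the span of the `A`.
  obtain ⟨j, k, hjk⟩ : ∃ j k, c j k ≠ 0 := by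
    by_contra! h0
    have hN : ∀ B ∈ Submodule.span ℂ
        (Set.range fun p : ι × ι => A p.1 ∘ₗ LinearMap.adjoint (A p.2)),
        partialTrace X X B = 0 := by
      intro B hB
      rw [← hA.span_eq] at hB
      rw [← Submodule.mem_bot ℂ]
      refine map_mem_of_mem_span _ ?_ hB
      rintro _ ⟨⟨j, k⟩, rfl⟩
      rw [Submodule.mem_bot]
      ext y
      rw [partialTrace_frobeniusComp_apply]
      simpa [h0] using hc j k y
    have hσ (j k : ι) :
        LinearMap.adjoint (A k) ∘ₗ (TensorProduct.comm ℂ X X).toLinearMap ∘ₗ A j = 0 := by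
      rw [← partialTrace_frobeniusComp_comm]
      exact hN _ (hA.comp_comm_mem (hA.frobenius_mem j k))
    obtain ⟨k, j, hkj⟩ := hA.special_ne_zero
    apply hkj
    have : LinearMap.adjoint (A k) ∘ₗ (TensorProduct.comm ℂ X X).toLinearMap ∘ₗ
        ((TensorProduct.comm ℂ X X).toLinearMap ∘ₗ A j) ∈ (⊥ : Submodule ℂ (X →ₗ[ℂ] X)) := by
      refine map_mem_of_mem_span (LinearMap.llcomp ℂ _ _ _ (LinearMap.adjoint (A k)) ∘ₗ
        LinearMap.llcomp ℂ _ _ _ (TensorProduct.comm ℂ X X).toLinearMap) ?_ (hA.comm_mem j)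
      rintro _ ⟨l, rfl⟩
      exact hσ l k
    rwa [Submodule.mem_bot, ← LinearMap.comp_assoc (A j), comm_comp_comm,
      LinearMap.id_comp] at this
  have hv : w j ≠ 0 := by
    intro h
    have h1 (y : X) : y = 0 := by
      have := hc j k y
      rw [h, TensorProduct.zero_tmul, map_zero] at this
      exact (smul_eq_zero.1 this.symm).resolve_left hjk
    obtain ⟨k, j, hkj⟩ := hA.special_ne_zero
    exact hkj (LinearMap.ext fun x => by rw [h1 x, map_zero, map_zero])
  refine ⟨w j, c j, ⟨k, hjk⟩, hc j, fun l => ?_⟩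
  -- Commutativity up to span makes `w j` a right unit too; the two scalars agree by comparing at `w
  -- j ⊗ₜ w j`.
  obtain ⟨c', hc'⟩ : ∃ c' : ℂ, ∀ y, LinearMap.adjoint (A l) (y ⊗ₜ[ℂ] w j) = c' • y := by
    let Φ : (X ⊗[ℂ] X →ₗ[ℂ] X) →ₗ[ℂ] (X →ₗ[ℂ] X) :=
      LinearMap.lcomp ℂ X (TensorProduct.mk ℂ X X (w j))
    have : Φ (LinearMap.adjoint (A l) ∘ₗ (TensorProduct.comm ℂ X X).toLinearMap) ∈
        Submodule.span ℂ {(LinearMap.id : X →ₗ[ℂ] X)} := by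
      refine map_mem_of_mem_span Φ ?_ (hA.mem_comm l)
      rintro _ ⟨i, rfl⟩
      exact Submodule.mem_span_singleton.2 ⟨c j i, LinearMap.ext fun y => (hc j i y).symm⟩
    obtain ⟨c', hc'⟩ := Submodule.mem_span_singleton.1 this
    exact ⟨c', fun y => by simpa [Φ] using (LinearMap.congr_fun hc' y).symm⟩
  have : c' = c j l := by
    have := (hc' (w j)).symm.trans (hc j l (w j))
    exact smul_left_injective ℂ hv this
  rwa [← this]

/-- All the operators are multiples of a single one. -/
theorem exists_forall_eq_smul : ∃ (g : X →ₗ[ℂ] X ⊗[ℂ] X) (c : ι → ℂ), ∀ k, A k = c k • g := by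
  obtain ⟨v, c, ⟨i, hi⟩, hl, hr⟩ := hA.exists_unit
  -- On a generator `A j ∘ₗ (A k)†` both sides equal `c k • A j x`, because `v` is a two-sided unit
  -- with the same scalars.
  have hN : ∀ B ∈ Submodule.span ℂ
      (Set.range fun p : ι × ι => A p.1 ∘ₗ LinearMap.adjoint (A p.2)),
      ∀ x, B (x ⊗ₜ[ℂ] v) = B (v ⊗ₜ[ℂ] x) := by
    intro B hB x
    rw [← sub_eq_zero, ← map_sub, ← Submodule.mem_bot ℂ]
    refine map_mem_of_mem_span (LinearMap.applyₗ (R := ℂ) (x ⊗ₜ[ℂ] v - v ⊗ₜ[ℂ] x)) ?_ hB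
    rintro _ ⟨⟨j, k⟩, rfl⟩
    simp [hl, hr]
  -- Move the unit across the Frobenius composite: evaluated at `v ⊗ₜ y` it gives the left side, at
  -- `y ⊗ₜ v` the right. Up to the factor `c k`, the product therefore does not depend on `k`.
  have key (k : ι) (x y : X) : ∀ d ∈ Submodule.span ℂ (Set.range A),
      LinearMap.adjoint (A k) (contract X x (d v) ⊗ₜ[ℂ] y) = c k • contract X x (d y) := by
    intro d hd
    induction hd using Submodule.span_induction with
    | mem d hd =>
      obtain ⟨j, rfl⟩ := hd
      rw [← contract_frobeniusComp, ← hN _ (hA.frobenius_mem j k),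
        frobeniusComp_tmul_of_unit (hr k), map_smul]
    | zero => simp
    | add d e _ _ hd he => simp [TensorProduct.add_tmul, hd, he]
    | smul a d _ hd =>
      simp only [LinearMap.smul_apply, map_smul, ← TensorProduct.smul_tmul', hd]
      rw [smul_comm]
  -- the vectors `⟨x| ⊗ id` applied to `A i v` span
  have htop : Submodule.span ℂ (Set.range fun x => contract X x (A i v)) = ⊤ := by
    rw [← Submodule.orthogonal_eq_bot_iff, Submodule.eq_bot_iff]
    intro φ hφ
    -- For `φ` orthogonal to these vectors, `φ` contracts the swapped `A i v` to zero. By `key` it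
    -- does so for every `A i y`, and then `c i • φ`, the product of `v` and `φ`, is zero.
    have h0 : contract X φ ((TensorProduct.comm ℂ X X) (A i v)) = 0 := by
      refine ext_inner_left ℂ fun x => ?_
      rw [← inner_tmul_left, inner_zero_right, ← TensorProduct.comm_tmul,
        TensorProduct.inner_comm_comm, inner_tmul_left]
      exact (Submodule.mem_orthogonal' _ _).1 hφ _ (Submodule.subset_span ⟨x, rfl⟩)
    have h1 (y : X) : contract X φ ((TensorProduct.comm ℂ X X) (A i y)) = 0 := by
      have := key i φ y _ (hA.comm_mem i)
      rw [LinearMap.comp_apply, LinearMap.comp_apply, LinearEquiv.coe_coe, h0,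
        TensorProduct.zero_tmul, map_zero] at this
      exact (smul_eq_zero.1 this.symm).resolve_left hi
    have h2 : c i • φ = 0 := by
      rw [← hl i φ]
      refine ext_inner_right ℂ fun y => ?_
      rw [LinearMap.adjoint_inner_left, ← TensorProduct.inner_comm_comm, TensorProduct.comm_tmul,
        inner_tmul_left, h1, inner_zero_right, inner_zero_left]
    exact (smul_eq_zero.1 h2).resolve_left hi
  -- By `htop` it suffices to test on first factors of the form in `key`.
  have hprop (k : ι) : c i • LinearMap.adjoint (A k) = c k • LinearMap.adjoint (A i) := by
    refine TensorProduct.ext' fun x y => ?_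
    have hx : x ∈ Submodule.span ℂ (Set.range fun x => contract X x (A i v)) :=
      htop ▸ Submodule.mem_top
    rw [← sub_eq_zero, ← LinearMap.sub_apply, ← Submodule.mem_bot ℂ]
    refine map_mem_of_mem_span
      ((c i • LinearMap.adjoint (A k) - c k • LinearMap.adjoint (A i)) ∘ₗ
        (TensorProduct.mk ℂ X X).flip y) ?_ hx
    rintro _ ⟨z, rfl⟩
    have h1 (k : ι) := key k z y (A i) (Submodule.subset_span ⟨i, rfl⟩)
    simp [h1, smul_smul, mul_comm]
  refine ⟨A i, fun k => starRingEnd ℂ (c k / c i), fun k => ?_⟩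
  apply LinearMap.adjoint.injective
  rw [LinearMap.adjoint.map_smulₛₗ, Complex.conj_conj, div_eq_inv_mul, mul_smul, ← hprop,
    inv_smul_smul₀ hi]

end IsFrobeniusSpan

end KrausSpans

end CPM

namespace CPM

/-! ### Classical structures in completely positive maps are canonical -/

section Canonical

variable {X ι : Type*} [NormedAddCommGroup X] [InnerProductSpace ℂ X] [FiniteDimensional ℂ X]
  [Fintype ι]

theorem IsCompletelyPositive.exists_sum_induced {Y : Type*} [NormedAddCommGroup Y]
    [InnerProductSpace ℂ Y] [FiniteDimensional ℂ Y] {Φ : (X →ₗ[ℂ] X) →ₗ[ℂ] (Y →ₗ[ℂ] Y)}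
    (h : IsCompletelyPositive Φ) :
    ∃ (k : ℕ) (A : Fin k → X →ₗ[ℂ] Y), Φ = ∑ i, induced (A i) := by
  obtain ⟨k, f, rfl⟩ := h
  exact ⟨k, _, ofKraus_eq_sum (EuclideanSpace.basisFun (Fin k) ℂ) f⟩

theorem adjoint_toLinearMap_of_inner {H K : Type*} [NormedAddCommGroup H] [InnerProductSpace ℂ H]
    [FiniteDimensional ℂ H] [NormedAddCommGroup K] [InnerProductSpace ℂ K] [FiniteDimensional ℂ K]
    (e : H ≃ₗ[ℂ] K) (he : ∀ x y, inner ℂ (e x) (e y) = inner ℂ x y) :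
    LinearMap.adjoint e.toLinearMap = e.symm.toLinearMap := by
  refine ((LinearMap.eq_adjoint_iff _ _).2 fun s t => ?_).symm
  rw [LinearEquiv.coe_coe, LinearEquiv.coe_coe, ← he, LinearEquiv.apply_symm_apply]

theorem adjoint_comm : LinearMap.adjoint (TensorProduct.comm ℂ X X).toLinearMap =
    (TensorProduct.comm ℂ X X).toLinearMap :=
  adjoint_toLinearMap_of_inner (TensorProduct.comm ℂ X X) TensorProduct.inner_comm_comm

theorem induced_comp_comp {X Y Z W : Type*}
    [NormedAddCommGroup X] [InnerProductSpace ℂ X] [FiniteDimensional ℂ X]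
    [NormedAddCommGroup Y] [InnerProductSpace ℂ Y] [FiniteDimensional ℂ Y]
    [NormedAddCommGroup Z] [InnerProductSpace ℂ Z] [FiniteDimensional ℂ Z]
    [NormedAddCommGroup W] [InnerProductSpace ℂ W] [FiniteDimensional ℂ W]
    (h : Z →ₗ[ℂ] W) (g : Y →ₗ[ℂ] Z) (f : X →ₗ[ℂ] Y) :
    induced (h ∘ₗ g ∘ₗ f) = induced h ∘ₗ induced g ∘ₗ induced f := by
  rw [induced_comp, induced_comp]

theorem induced_frobeniusComp (d : X →ₗ[ℂ] X ⊗[ℂ] X) (m : X ⊗[ℂ] X →ₗ[ℂ] X) :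
    induced (frobeniusComp d m) =
      tensor (LinearMap.id : (X →ₗ[ℂ] X) →ₗ[ℂ] (X →ₗ[ℂ] X)) (induced m)
      ∘ₗ induced (TensorProduct.assoc ℂ X X X).toLinearMap
      ∘ₗ tensor (induced d) (LinearMap.id : (X →ₗ[ℂ] X) →ₗ[ℂ] (X →ₗ[ℂ] X)) := by
  rw [← induced_id, tensor_induced, tensor_induced]
  exact induced_comp_comp (X := X ⊗[ℂ] X) (Y := X ⊗[ℂ] X ⊗[ℂ] X) (Z := X ⊗[ℂ] (X ⊗[ℂ] X))
    (W := X ⊗[ℂ] X) _ _ _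

/-- The right-hand composite is the adjoint of the left-hand one, and `g ∘ₗ g†` is self-adjoint; the
proof compares matrix elements on pure tensors. -/
theorem frobenius_right_of_left {g : X →ₗ[ℂ] X ⊗[ℂ] X}
    (h : frobeniusComp g (LinearMap.adjoint g) = g ∘ₗ LinearMap.adjoint g) :
    TensorProduct.map (LinearMap.adjoint g) (LinearMap.id : X →ₗ[ℂ] X)
      ∘ₗ (TensorProduct.assoc ℂ X X X).symm.toLinearMap
      ∘ₗ TensorProduct.map (LinearMap.id : X →ₗ[ℂ] X) g = g ∘ₗ LinearMap.adjoint g := by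
  refine TensorProduct.ext' fun x y => TensorProduct.ext_iff_inner_right.2 fun a b => ?_
  have key (t : X ⊗[ℂ] X) : inner ℂ (TensorProduct.map (LinearMap.adjoint g) LinearMap.id
      ((TensorProduct.assoc ℂ X X X).symm (x ⊗ₜ[ℂ] t))) (a ⊗ₜ[ℂ] b) =
      inner ℂ t (contract X x (g a) ⊗ₜ[ℂ] b) := by
    induction t with
    | zero => simp
    | add s t hs ht => simp [TensorProduct.tmul_add, inner_add_left, hs, ht]
    | tmul p q =>
      simp [TensorProduct.inner_tmul, LinearMap.adjoint_inner_left, inner_tmul_left]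
  rw [LinearMap.comp_apply, LinearMap.comp_apply, TensorProduct.map_tmul, LinearEquiv.coe_coe,
    LinearMap.id_apply, key, ← LinearMap.adjoint_inner_right, ← contract_frobeniusComp, h,
    ← inner_tmul_left, LinearMap.comp_apply, LinearMap.comp_apply, ← LinearMap.adjoint_inner_left g,
    ← LinearMap.adjoint_inner_right g]

theorem exists_special_ne_zero [Nontrivial X] {A : ι → X →ₗ[ℂ] X ⊗[ℂ] X}
    (h : ∑ p : ι × ι, induced (LinearMap.adjoint (A p.1) ∘ₗ A p.2) = LinearMap.id) :
    ∃ j k, LinearMap.adjoint (A j) ∘ₗ A k ≠ 0 := by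
  by_contra! h0
  have : (LinearMap.id : (X →ₗ[ℂ] X) →ₗ[ℂ] (X →ₗ[ℂ] X)) = 0 := by
    rw [← h]
    refine Finset.sum_eq_zero fun p _ => ?_
    ext ρ x
    simp [induced_apply, h0]
  exact one_ne_zero (LinearMap.congr_fun this (1 : X →ₗ[ℂ] X))

/-- Expanding each law in Kraus operators gives two Kraus families of one map, whose spans can be
compared. -/
theorem IsClassicalStructure.isFrobeniusSpan [Nontrivial X]
    {δ : (X →ₗ[ℂ] X) →ₗ[ℂ] ((X ⊗[ℂ] X) →ₗ[ℂ] (X ⊗[ℂ] X))} (hδ : IsClassicalStructure δ)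
    {A : ι → X →ₗ[ℂ] X ⊗[ℂ] X} (hA : δ = ∑ k, induced (A k)) : IsFrobeniusSpan A := by
  have hd : dagger δ = ∑ k, induced (LinearMap.adjoint (A k)) := by
    simp [hA, dagger_sum, dagger_induced]
  have comp_sum {U V W : Type _} [AddCommGroup U] [AddCommGroup V] [AddCommGroup W]
      [Module ℂ U] [Module ℂ V] [Module ℂ W] (f : ι → V →ₗ[ℂ] W) (g : ι → U →ₗ[ℂ] V) :
      (∑ j, f j) ∘ₗ (∑ k, g k) = ∑ p : ι × ι, f p.1 ∘ₗ g p.2 := by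
    ext x
    simp [Fintype.sum_prod_type]
  have hfrob : ∑ p : ι × ι, induced (frobeniusComp (A p.2) (LinearMap.adjoint (A p.1))) =
      ∑ p : ι × ι, induced (A p.1 ∘ₗ LinearMap.adjoint (A p.2)) := by
    have h := hδ.frobenius_left
    rw [hd, hA, tensor_sum_left, tensor_sum_right, comp_sum] at h
    simp only [← induced_comp] at h
    rw [← h]
    ext ρ : 1
    simp [Fintype.sum_prod_type, induced_frobeniusComp]
  have hspecial : ∑ p : ι × ι, induced (LinearMap.adjoint (A p.1) ∘ₗ A p.2) = LinearMap.id := by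
    have h := hδ.special
    rw [hd, hA, comp_sum] at h
    simpa only [← induced_comp] using h
  have hcomm : ∑ k, induced ((TensorProduct.comm ℂ X X).toLinearMap ∘ₗ A k) =
      ∑ k, induced (A k) := by
    have h := hδ.commutative
    rw [hA] at h
    rw [← h]
    ext ρ : 1
    simp [induced_comp]
  have hcomm' : ∑ k, induced (LinearMap.adjoint (A k) ∘ₗ (TensorProduct.comm ℂ X X).toLinearMap) =
      ∑ k, induced (LinearMap.adjoint (A k)) := by
    simpa [dagger_sum, dagger_induced, LinearMap.adjoint_comp, adjoint_comm] using
      congrArg dagger hcomm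
  exact
    { frobenius_mem := fun j k => mem_span_of_sum_induced_eq hfrob (k, j)
      mem_frobenius := fun j k => by
        refine Submodule.span_mono ?_ (mem_span_of_sum_induced_eq hfrob.symm (j, k))
        rintro _ ⟨p, rfl⟩
        exact ⟨p.swap, rfl⟩
      special_mem := fun j k => by
        have := mem_span_of_sum_induced_eq (B := fun _ : Unit => (LinearMap.id : X →ₗ[ℂ] X))
          (hspecial.trans (by simp [induced_id])) (j, k)
        rwa [Set.range_const] at this
      special_ne_zero := exists_special_ne_zero hspecial
      comm_mem := mem_span_of_sum_induced_eq hcomm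
      mem_comm := mem_span_of_sum_induced_eq hcomm' }

theorem IsClassicalStructure.exists_eq_induced [Nontrivial X]
    {δ : (X →ₗ[ℂ] X) →ₗ[ℂ] ((X ⊗[ℂ] X) →ₗ[ℂ] (X ⊗[ℂ] X))} (hδ : IsClassicalStructure δ) :
    ∃ g : X →ₗ[ℂ] X ⊗[ℂ] X, δ = induced g := by
  obtain ⟨n, A, hA⟩ := hδ.completelyPositive.exists_sum_induced
  obtain ⟨g, c, hg⟩ := (hδ.isFrobeniusSpan hA).exists_forall_eq_smul
  -- Proportional Kraus operators `c k • g` merge into one, since each contributes the weight `‖c k‖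
  -- ^ 2`.
  refine ⟨((√(∑ k, ‖c k‖ ^ 2) : ℝ) : ℂ) • g, ?_⟩
  rw [induced_smul, Complex.conj_ofReal, ← Complex.ofReal_mul,
    Real.mul_self_sqrt (by positivity), hA]
  simp [hg, induced_smul, Complex.mul_conj', ← Finset.sum_smul]

/-- Every classical structure in completely positive maps is canonical. The adjoints of the Kraus
operators of `δ` have a common unit up to scalars (`IsFrobeniusSpan.exists_unit`), which forces
these operators to be proportional (`IsFrobeniusSpan.exists_forall_eq_smul`); evaluation at the
unit then shows that the laws hold for the single Kraus operator, with no phases. -/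
theorem IsClassicalStructure.isCanonical [Nontrivial X]
    {δ : (X →ₗ[ℂ] X) →ₗ[ℂ] ((X ⊗[ℂ] X) →ₗ[ℂ] (X ⊗[ℂ] X))} (hδ : IsClassicalStructure δ) :
    IsCanonical δ := by
  obtain ⟨g, rfl⟩ := hδ.exists_eq_induced
  have hA : IsFrobeniusSpan fun _ : Unit => g := hδ.isFrobeniusSpan (by simp)
  obtain ⟨v, c, ⟨⟨⟩, hc⟩, hl, hr⟩ := hA.exists_unit
  replace hl := hl ()
  replace hr := hr ()
  generalize c () = c at *
  obtain ⟨x, hx⟩ := exists_ne (0 : X)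
  obtain ⟨s, hs⟩ : ∃ s : ℂ, s • LinearMap.id = LinearMap.adjoint g ∘ₗ g :=
    Submodule.mem_span_singleton.1 (hA.special_mem () ())
  -- The special law of `δ` only gives `|s| = 1`; positivity of `g† g` makes `s` a nonnegative real.
  have hs1 : s = 1 := by
    have h1 : s * starRingEnd ℂ s = 1 := by
      have h := hδ.special
      rw [dagger_induced, ← induced_comp, ← hs, induced_smul, induced_id] at h
      have h2 := LinearMap.congr_fun (LinearMap.congr_fun h LinearMap.id) x
      exact smul_left_injective ℂ hx (by simpa using h2)
    have h2 : s * (‖x‖ ^ 2 : ℝ) = (‖g x‖ ^ 2 : ℝ) := by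
      have h3 : inner ℂ x (s • x) = inner ℂ (g x) (g x) := by
        rw [← LinearMap.adjoint_inner_right]
        exact congrArg (inner ℂ x) (LinearMap.congr_fun hs x)
      rw [inner_smul_right, inner_self_eq_norm_sq_to_K (𝕜 := ℂ) x,
        inner_self_eq_norm_sq_to_K (𝕜 := ℂ) (g x)] at h3
      exact_mod_cast h3
    have hx' : (‖x‖ ^ 2 : ℝ) ≠ 0 := by positivity
    have h3 : s = ((‖g x‖ ^ 2 / ‖x‖ ^ 2 : ℝ) : ℂ) := by
      rw [Complex.ofReal_div, eq_div_iff (by exact_mod_cast hx'), h2]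
    rw [h3, Complex.conj_ofReal, ← Complex.ofReal_mul] at h1
    have h4 : (‖g x‖ ^ 2 / ‖x‖ ^ 2 : ℝ) = 1 := by
      have h5 : (‖g x‖ ^ 2 / ‖x‖ ^ 2 : ℝ) * (‖g x‖ ^ 2 / ‖x‖ ^ 2 : ℝ) = 1 := by exact_mod_cast h1
      have : (0 : ℝ) ≤ ‖g x‖ ^ 2 / ‖x‖ ^ 2 := by positivity
      nlinarith
    rw [h3, h4, Complex.ofReal_one]
  have hspecial : LinearMap.adjoint g ∘ₗ g = LinearMap.id := by rw [← hs, hs1, one_smul]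
  have hgx : g x ≠ 0 := fun h => hx <| by
    simpa [h] using (LinearMap.congr_fun hspecial x).symm
  have hfrob : frobeniusComp g (LinearMap.adjoint g) = g ∘ₗ LinearMap.adjoint g := by
    obtain ⟨z, hz⟩ : ∃ z : ℂ, z • (g ∘ₗ LinearMap.adjoint g) =
        frobeniusComp g (LinearMap.adjoint g) := by
      have := hA.frobenius_mem () ()
      rwa [Set.range_const, Submodule.mem_span_singleton] at this
    -- Both composites send `x ⊗ₜ v` to `c • g x`, which is nonzero, so the phase `z` is 1.
    have h1 := LinearMap.congr_fun hz (x ⊗ₜ[ℂ] v)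
    rw [frobeniusComp_tmul_of_unit hr, LinearMap.smul_apply, LinearMap.comp_apply, hr, map_smul,
      smul_smul] at h1
    have h2 := smul_left_injective ℂ hgx h1
    rw [← hz, mul_eq_right₀ hc |>.1 h2, one_smul]
  have hcomm : (TensorProduct.comm ℂ X X).toLinearMap ∘ₗ g = g := by
    have h0 : LinearMap.adjoint g ∘ₗ (TensorProduct.comm ℂ X X).toLinearMap =
        LinearMap.adjoint g := by
      obtain ⟨z, hz⟩ : ∃ z : ℂ, z • LinearMap.adjoint g =
          LinearMap.adjoint g ∘ₗ (TensorProduct.comm ℂ X X).toLinearMap := by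
        have := hA.mem_comm ()
        rwa [Set.range_const, Submodule.mem_span_singleton] at this
      have h1 := LinearMap.congr_fun hz (v ⊗ₜ[ℂ] x)
      rw [LinearMap.smul_apply, LinearMap.comp_apply, LinearEquiv.coe_coe,
        TensorProduct.comm_tmul, hl, hr, smul_smul] at h1
      have h2 := smul_left_injective ℂ hx h1
      rw [← hz, mul_eq_right₀ hc |>.1 h2, one_smul]
    simpa [LinearMap.adjoint_comp, adjoint_comm] using congrArg LinearMap.adjoint h0
  exact ⟨g, ⟨hfrob, frobenius_right_of_left hfrob, hspecial, hcomm⟩, rfl⟩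

end Canonical

end CPM

namespace FdHilb

/-! ### Copyable vectors of a classical structure on a Hilbert space -/

section Copyables

variable {X : Type*} [NormedAddCommGroup X] [InnerProductSpace ℂ X] [FiniteDimensional ℂ X]

/-- Multiplication from the left by a vector, for the multiplication `g†`. -/
noncomputable def mulLeft (g : X →ₗ[ℂ] X ⊗[ℂ] X) : X →ₗ[ℂ] X →ₗ[ℂ] X :=
  LinearMap.compr₂ (TensorProduct.mk ℂ X X) (LinearMap.adjoint g)

theorem mulLeft_apply (g : X →ₗ[ℂ] X ⊗[ℂ] X) (x y : X) :
    mulLeft g x y = LinearMap.adjoint g (x ⊗ₜ[ℂ] y) := rfl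

theorem adjoint_mulLeft (g : X →ₗ[ℂ] X ⊗[ℂ] X) (x : X) :
    LinearMap.adjoint (mulLeft g x) = CPM.contract X x ∘ₗ g := by
  refine ((LinearMap.eq_adjoint_iff _ _).2 fun s t => ?_).symm
  rw [mulLeft_apply, LinearMap.adjoint_inner_right, LinearMap.comp_apply, ← inner_conj_symm,
    ← CPM.inner_tmul_left]
  exact inner_conj_symm (𝕜 := ℂ) (g s) (x ⊗ₜ[ℂ] t)

/-- A vector is copyable as soon as the functional it represents is multiplicative for `g†`. -/
theorem eq_tmul_self_of_inner {g : X →ₗ[ℂ] X ⊗[ℂ] X} {k : X}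
    (h : ∀ x y, inner ℂ k (mulLeft g x y) = inner ℂ k x * inner ℂ k y) :
    g k = k ⊗ₜ[ℂ] k := by
  refine TensorProduct.ext_iff_inner_right.2 fun x y => ?_
  rw [← LinearMap.adjoint_inner_right, TensorProduct.inner_tmul, ← h, mulLeft_apply]

namespace IsClassicalStructure

variable {g : X →ₗ[ℂ] X ⊗[ℂ] X} (hg : IsClassicalStructure g)
include hg

theorem inner_map_map (x y : X) : inner ℂ (g x) (g y) = inner ℂ x y := by
  rw [← LinearMap.adjoint_inner_right]
  exact congrArg (inner ℂ x) (LinearMap.congr_fun hg.special y)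

theorem frobeniusComp_eq :
    CPM.frobeniusComp g (LinearMap.adjoint g) = g ∘ₗ LinearMap.adjoint g := hg.frobenius_left

theorem isFrobeniusSpan [Nontrivial X] : CPM.IsFrobeniusSpan fun _ : Unit => g := by
  have hcomm : LinearMap.adjoint g ∘ₗ (TensorProduct.comm ℂ X X).toLinearMap =
      LinearMap.adjoint g := by
    conv_rhs => rw [← hg.commutative, LinearMap.adjoint_comp, CPM.adjoint_comm]
  exact
    { frobenius_mem := fun _ _ => by
        rw [hg.frobeniusComp_eq]; exact Submodule.subset_span ⟨((), ()), rfl⟩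
      mem_frobenius := fun _ _ => by
        rw [← hg.frobeniusComp_eq]; exact Submodule.subset_span ⟨((), ()), rfl⟩
      special_mem := fun _ _ => by rw [hg.special]; exact Submodule.mem_span_singleton_self _
      special_ne_zero := ⟨(), (), by rw [hg.special]; exact one_ne_zero⟩
      comm_mem := fun _ => by rw [hg.commutative]; exact Submodule.subset_span ⟨(), rfl⟩
      mem_comm := fun _ => by rw [hcomm]; exact Submodule.subset_span ⟨(), rfl⟩ }

theorem exists_mulLeft_unit [Nontrivial X] :
    ∃ v : X, (∀ y, mulLeft g v y = y) ∧ ∀ y, mulLeft g y v = y := by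
  obtain ⟨v, c, ⟨⟨⟩, hc⟩, hl, hr⟩ := hg.isFrobeniusSpan.exists_unit
  refine ⟨(c ())⁻¹ • v, fun y => ?_, fun y => ?_⟩
  · rw [map_smul, LinearMap.smul_apply, mulLeft_apply, hl () y, inv_smul_smul₀ hc]
  · rw [map_smul, mulLeft_apply, hr () y, inv_smul_smul₀ hc]

theorem mulLeft_comm (x y : X) : mulLeft g x y = mulLeft g y x := by
  refine ext_inner_right ℂ fun z => ?_
  rw [mulLeft_apply, mulLeft_apply, LinearMap.adjoint_inner_left, LinearMap.adjoint_inner_left,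
    ← TensorProduct.inner_comm_comm, TensorProduct.comm_tmul]
  exact congrArg (inner ℂ (y ⊗ₜ[ℂ] x)) (LinearMap.congr_fun hg.commutative z)

/-- This is the Frobenius law contracted with `z` in the first factor. -/
theorem adjoint_mulLeft_mulLeft (z x y : X) :
    LinearMap.adjoint (mulLeft g z) (mulLeft g x y) =
      mulLeft g (LinearMap.adjoint (mulLeft g z) x) y := by
  rw [adjoint_mulLeft, mulLeft_apply, mulLeft_apply, LinearMap.comp_apply, LinearMap.comp_apply,
    ← CPM.contract_frobeniusComp, hg.frobeniusComp_eq, LinearMap.comp_apply]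

theorem exists_adjoint_mulLeft_eq [Nontrivial X] (x : X) :
    ∃ x', LinearMap.adjoint (mulLeft g x) = mulLeft g x' := by
  obtain ⟨v, hl, -⟩ := hg.exists_mulLeft_unit
  refine ⟨LinearMap.adjoint (mulLeft g x) v, LinearMap.ext fun y => ?_⟩
  rw [← hg.adjoint_mulLeft_mulLeft, hl]

/-- By Frobenius and commutativity, adjoints of multiplications commute with multiplications; and
every multiplication is such an adjoint. -/
theorem commute_mulLeft [Nontrivial X] (x y : X) : Commute (mulLeft g x) (mulLeft g y) := by
  have h (z : X) : Commute (LinearMap.adjoint (mulLeft g z)) (mulLeft g y) := by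
    refine LinearMap.ext fun w => ?_
    rw [Module.End.mul_apply, Module.End.mul_apply, hg.mulLeft_comm y w,
      hg.adjoint_mulLeft_mulLeft, hg.mulLeft_comm y]
  obtain ⟨x', hx'⟩ := hg.exists_adjoint_mulLeft_eq x
  have := h x'
  rwa [← hx', LinearMap.adjoint_adjoint] at this

/-- For a joint eigenvector `b`, the functional `⟨b, ·⟩` is multiplicative up to scale. Dividing by
its value at the unit `v` makes it a character, so the rescaled `b` is copyable. -/
theorem exists_copyable_smul [Nontrivial X] {b : X}
    (hb : ∀ x, ∃ a : ℂ, mulLeft g x b = a • b) :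
    ∃ (k : X) (a : ℂ), g k = k ⊗ₜ[ℂ] k ∧ b = a • k := by
  rcases eq_or_ne b 0 with rfl | hb0
  · exact ⟨0, 0, by simp, by simp⟩
  obtain ⟨v, -, hr⟩ := hg.exists_mulLeft_unit
  choose T hT using hg.exists_adjoint_mulLeft_eq
  choose f hf using hb
  have key (x y : X) : inner ℂ b (mulLeft g x y) = starRingEnd ℂ (f (T x)) * inner ℂ b y := by
    rw [← LinearMap.adjoint_inner_left, hT, hf, inner_smul_left]
  have hx (x : X) : inner ℂ b x = starRingEnd ℂ (f (T x)) * inner ℂ b v := by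
    rw [← key, hr]
  have hbv : inner ℂ b v ≠ 0 := fun h => hb0 <| by
    have := hx b
    rwa [h, mul_zero, inner_self_eq_zero] at this
  refine ⟨(starRingEnd ℂ (inner ℂ b v))⁻¹ • b, starRingEnd ℂ (inner ℂ b v),
    eq_tmul_self_of_inner fun x y => ?_, ?_⟩
  · simp only [inner_smul_left, map_inv₀, Complex.conj_conj]
    rw [key x y, hx x]
    field_simp
  · rw [smul_inv_smul₀]
    exact (map_ne_zero _).2 hbv

/-- The self-adjoint multiplications commute, so their joint eigenspaces span. The other
multiplications are complex combinations of self-adjoint ones, so joint eigenvectors of the latter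
are eigenvectors of all. -/
theorem span_copyable [Nontrivial X] : Submodule.span ℂ {k : X | g k = k ⊗ₜ[ℂ] k} = ⊤ := by
  have hcomm : Pairwise (Function.onFun Commute
      fun x : {x : X // (mulLeft g x).IsSymmetric} => mulLeft g x) :=
    fun x y _ => hg.commute_mulLeft x y
  rw [eq_top_iff, ← LinearMap.IsSymmetric.iSup_iInf_eq_top_of_commute
    (T := fun x : {x : X // (mulLeft g x).IsSymmetric} => mulLeft g x) (fun x => x.2) hcomm]
  refine iSup_le fun χ b hb => ?_
  obtain ⟨k, a, hk, rfl⟩ : ∃ (k : X) (a : ℂ), g k = k ⊗ₜ[ℂ] k ∧ b = a • k := by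
    refine hg.exists_copyable_smul fun x => ?_
    have hs (y : X) (hy : (mulLeft g y).IsSymmetric) : ∃ a : ℂ, mulLeft g y b = a • b :=
      ⟨χ ⟨y, hy⟩, Module.End.mem_eigenspace_iff.1 ((Submodule.mem_iInf _).1 hb ⟨y, hy⟩)⟩
    obtain ⟨x', hx'⟩ := hg.exists_adjoint_mulLeft_eq x
    have hx'' : LinearMap.adjoint (mulLeft g x') = mulLeft g x := by
      rw [← hx', LinearMap.adjoint_adjoint]
    obtain ⟨a₁, h₁⟩ := hs (x + x') <| by
      rw [LinearMap.isSymmetric_iff_isSelfAdjoint, LinearMap.isSelfAdjoint_iff', map_add, map_add,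
        hx', hx'', add_comm]
    obtain ⟨a₂, h₂⟩ := hs (Complex.I • (x - x')) <| by
      rw [LinearMap.isSymmetric_iff_isSelfAdjoint, LinearMap.isSelfAdjoint_iff', map_smul, map_sub,
        LinearMap.adjoint.map_smulₛₗ, map_sub, hx', hx'', Complex.conj_I, neg_smul, ← smul_neg,
        neg_sub]
    -- From `x = (1/2)(x + x') - (i/2)(i(x - x'))`, the decomposition into self-adjoint parts.
    refine ⟨(1 / 2 : ℂ) * a₁ - (Complex.I / 2) * a₂, ?_⟩
    rw [sub_smul, mul_smul, mul_smul, ← h₁, ← h₂, ← LinearMap.flip_apply (mulLeft g),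
      ← LinearMap.flip_apply (mulLeft g), ← LinearMap.flip_apply (mulLeft g), ← map_smul,
      ← map_smul, ← map_sub]
    congr 1
    rw [smul_smul, show Complex.I / 2 * Complex.I = -(1 / 2 : ℂ) by
      linear_combination (1 / 2 : ℂ) * Complex.I_mul_I]
    module
  exact Submodule.smul_mem _ _ (Submodule.subset_span hk)

/-- As `g` is isometric, `⟨a, b⟩ = ⟨a, b⟩ ^ 2` for copyable `a`, `b`, so the value is 0 or 1; among
unit vectors the value 1 forces `a = b`. -/
theorem orthonormal_copyable :
    Orthonormal ℂ (fun k : {k : X // k ≠ 0 ∧ g k = k ⊗ₜ[ℂ] k} => (k : X)) := by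
  have hsq {a b : X} (ha : g a = a ⊗ₜ[ℂ] a) (hb : g b = b ⊗ₜ[ℂ] b) :
      (inner ℂ a b : ℂ) = 0 ∨ (inner ℂ a b : ℂ) = 1 := by
    have h := hg.inner_map_map a b
    rw [ha, hb, TensorProduct.inner_tmul] at h
    rcases eq_or_ne (inner ℂ a b : ℂ) 0 with h0 | h0
    · exact Or.inl h0
    · exact Or.inr ((mul_eq_right₀ h0).1 h)
  have hself {a : X} (h0 : a ≠ 0) (ha : g a = a ⊗ₜ[ℂ] a) : (inner ℂ a a : ℂ) = 1 :=
    (hsq ha ha).resolve_left (mt inner_self_eq_zero.1 h0)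
  classical
  rw [orthonormal_iff_ite]
  rintro ⟨a, ha0, ha⟩ ⟨b, hb0, hb⟩
  split_ifs with hab
  · obtain rfl : a = b := congrArg Subtype.val hab
    exact hself ha0 ha
  · refine (hsq ha hb).resolve_right fun h1 => hab (Subtype.ext ?_)
    have h2 : (inner ℂ b a : ℂ) = 1 := by rw [← inner_conj_symm, h1, map_one]
    change a = b
    rw [← sub_eq_zero, ← inner_self_eq_zero (𝕜 := ℂ), inner_sub_left, inner_sub_right,
      inner_sub_right, hself ha0 ha, hself hb0 hb, h1, h2]
    ring

theorem exists_orthonormalBasis_copyable [Nontrivial X] :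
    ∃ (n : ℕ) (b : OrthonormalBasis (Fin n) ℂ X), ∀ i, g (b i) = b i ⊗ₜ[ℂ] b i := by
  have hon := hg.orthonormal_copyable
  have : Finite {k : X // k ≠ 0 ∧ g k = k ⊗ₜ[ℂ] k} := hon.linearIndependent.finite
  have := Fintype.ofFinite {k : X // k ≠ 0 ∧ g k = k ⊗ₜ[ℂ] k}
  have hspan : ⊤ ≤ Submodule.span ℂ
      (Set.range fun k : {k : X // k ≠ 0 ∧ g k = k ⊗ₜ[ℂ] k} => (k : X)) := by
    rw [← hg.span_copyable, Submodule.span_le]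
    intro k hk
    rcases eq_or_ne k 0 with rfl | h0
    · exact Submodule.zero_mem _
    · exact Submodule.subset_span ⟨⟨k, h0, hk⟩, rfl⟩
  let e := Fintype.equivFin {k : X // k ≠ 0 ∧ g k = k ⊗ₜ[ℂ] k}
  refine ⟨_, (OrthonormalBasis.mk hon hspan).reindex e, fun i => ?_⟩
  simpa using (e.symm i).2.2

end IsClassicalStructure

end Copyables

end FdHilb

namespace CPM

/-! ### Pure states, ranks, traces and Kraus decompositions -/

section Consequences

variable {X : Type*} [NormedAddCommGroup X] [InnerProductSpace ℂ X] [FiniteDimensional ℂ X]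

theorem induced_rankOne {Y : Type*} [NormedAddCommGroup Y] [InnerProductSpace ℂ Y]
    [FiniteDimensional ℂ Y] (f : X →ₗ[ℂ] Y) (ψ : X) :
    induced f (InnerProductSpace.rankOne ℂ ψ ψ).toLinearMap =
      (InnerProductSpace.rankOne ℂ (f ψ) (f ψ)).toLinearMap := by
  ext y
  simp [induced_apply, LinearMap.adjoint_inner_right]

omit [FiniteDimensional ℂ X] in
theorem map_rankOne (k : X) :
    TensorProduct.map (InnerProductSpace.rankOne ℂ k k).toLinearMap
      (InnerProductSpace.rankOne ℂ k k).toLinearMap =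
      (InnerProductSpace.rankOne ℂ (k ⊗ₜ[ℂ] k) (k ⊗ₜ[ℂ] k)).toLinearMap := by
  refine TensorProduct.ext' fun x y => ?_
  simp [TensorProduct.inner_tmul, ← TensorProduct.smul_tmul', smul_smul, mul_comm]

theorem finrank_range_map (α : X →ₗ[ℂ] X) :
    Module.finrank ℂ (LinearMap.range (TensorProduct.map α α)) =
      Module.finrank ℂ (LinearMap.range α) * Module.finrank ℂ (LinearMap.range α) := by
  let R := LinearMap.range α
  have hfac : TensorProduct.map α α = TensorProduct.map R.subtype R.subtype ∘ₗ
      TensorProduct.map α.rangeRestrict α.rangeRestrict := by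
    rw [← TensorProduct.map_comp]
    rfl
  have hsurj : LinearMap.range (TensorProduct.map α.rangeRestrict α.rangeRestrict) = ⊤ :=
    LinearMap.range_eq_top.2
      (TensorProduct.map_surjective α.surjective_rangeRestrict α.surjective_rangeRestrict)
  have hinj : Function.Injective (TensorProduct.map R.subtype R.subtype) :=
    TensorProduct.map_injective_of_flat_flat _ _ R.injective_subtype R.injective_subtype
  rw [hfac, LinearMap.range_comp_of_range_eq_top _ hsurj, LinearMap.finrank_range_of_inj hinj,
    Module.finrank_tensorProduct]

/-- Contraction with a unit vector is a one-dimensional Kraus decomposition of `induced g`. -/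
theorem hasKrausAncilla_one_induced {Y : Type*} [NormedAddCommGroup Y] [InnerProductSpace ℂ Y]
    [FiniteDimensional ℂ Y] (g : X →ₗ[ℂ] Y) : HasKrausAncilla (induced g) 1 := by
  let b := EuclideanSpace.basisFun (Fin 1) ℂ
  refine ⟨TensorProduct.mk ℂ _ Y (b 0) ∘ₗ g, ?_⟩
  rw [ofKraus_eq_sum b, Fin.sum_univ_one]
  congr 1
  ext x
  simp

theorem HasKrausAncilla.eq_zero {Y : Type*} [NormedAddCommGroup Y] [InnerProductSpace ℂ Y]
    [FiniteDimensional ℂ Y] {Φ : (X →ₗ[ℂ] X) →ₗ[ℂ] (Y →ₗ[ℂ] Y)} (h : HasKrausAncilla Φ 0) :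
    Φ = 0 := by
  obtain ⟨f, rfl⟩ := h
  rw [ofKraus_eq_sum (EuclideanSpace.basisFun (Fin 0) ℂ)]
  simp

theorem IsCopyable.adjoint {g : X →ₗ[ℂ] X ⊗[ℂ] X} {α : X →ₗ[ℂ] X} (hα : IsCopyable (induced g) α) :
    IsCopyable (induced g) (LinearMap.adjoint α) := by
  rw [IsCopyable] at *
  rw [← TensorProduct.adjoint_map, ← hα]
  simp [induced_apply, LinearMap.adjoint_comp, LinearMap.comp_assoc]

theorem trace_ne_zero_of_isPositive {α : X →ₗ[ℂ] X} (hα : α.IsPositive) (h0 : α ≠ 0) :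
    LinearMap.trace ℂ X α ≠ 0 := by
  let b := (stdOrthonormalBasis ℂ X).toBasis
  rw [LinearMap.trace_eq_matrix_trace ℂ b, ne_eq, Matrix.PosSemidef.trace_eq_zero_iff
    ((LinearMap.posSemidef_toMatrix_iff (stdOrthonormalBasis ℂ X)).2 hα)]
  exact mt (LinearMap.toMatrix b b).map_eq_zero_iff.1 h0

end Consequences

end CPM

/-! ### The conditions for a canonical structure -/

namespace FdHilb.IsClassicalStructure

open CPM

variable {X : Type*} [NormedAddCommGroup X] [InnerProductSpace ℂ X] [FiniteDimensional ℂ X]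
  {g : X →ₗ[ℂ] X ⊗[ℂ] X} (hg : FdHilb.IsClassicalStructure g)
include hg

theorem special_apply (x : X) : LinearMap.adjoint g (g x) = x :=
  LinearMap.congr_fun hg.special x

theorem isPureState_induced {ρ : X →ₗ[ℂ] X} (hρ : IsPureState ρ) :
    IsPureState (induced g ρ) := by
  obtain ⟨ψ, hψ, rfl⟩ := hρ
  refine ⟨g ψ, ?_, induced_rankOne g ψ⟩
  rw [← hψ, norm_eq_sqrt_re_inner (𝕜 := ℂ), norm_eq_sqrt_re_inner (𝕜 := ℂ), hg.inner_map_map]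

theorem trace_induced (ρ : X →ₗ[ℂ] X) :
    LinearMap.trace ℂ (X ⊗[ℂ] X) (induced g ρ) = LinearMap.trace ℂ X ρ := by
  rw [induced_apply, LinearMap.trace_comp_comm', LinearMap.comp_assoc, hg.special,
    LinearMap.comp_id]

theorem dagger_induced_id : dagger (induced g) LinearMap.id = LinearMap.id := by
  rw [dagger_induced, induced_apply, LinearMap.adjoint_adjoint, LinearMap.id_comp, hg.special]

theorem induced_comp_induced (ρ τ : X →ₗ[ℂ] X) :
    induced g ρ ∘ₗ induced g τ = induced g (ρ ∘ₗ τ) := by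
  ext x
  simp [induced_apply, hg.special_apply]

/-- The projections onto an orthonormal basis of copyable vectors are copyable and resolve the
identity. -/
theorem exists_sum_copyable_eq_id [Nontrivial X] :
    ∃ A : Finset (X →ₗ[ℂ] X), (∀ α ∈ A, IsCopyable (induced g) α) ∧ ∑ α ∈ A, α = LinearMap.id := by
  classical
  obtain ⟨n, b, hb⟩ := hg.exists_orthonormalBasis_copyable
  let P : Fin n → X →ₗ[ℂ] X := fun i => (InnerProductSpace.rankOne ℂ (b i) (b i)).toLinearMap
  -- Distinctness is needed because the sum runs over a set of operators, not over indices.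
  have hinj : Function.Injective P := by
    intro i j hij
    by_contra hne
    have h := LinearMap.congr_fun hij (b i)
    simp only [P, ContinuousLinearMap.coe_coe, InnerProductSpace.rankOne_apply,
      b.inner_eq_ite, if_neg (Ne.symm hne)] at h
    exact b.orthonormal.ne_zero i (by simpa using h)
  refine ⟨Finset.univ.image P, ?_, ?_⟩
  · simp only [Finset.mem_image, Finset.mem_univ, true_and, forall_exists_index,
      forall_apply_eq_imp_iff]
    intro i
    simp only [P, IsCopyable]
    rw [induced_rankOne, hb, map_rankOne]
  · rw [Finset.sum_image hinj.injOn]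
    ext x
    simp [P, b.sum_repr']

theorem trace_eq_one_of_isCopyable {α : X →ₗ[ℂ] X} (hα : IsCopyable (induced g) α) (h0 : α ≠ 0)
    (hpos : α.IsPositive) : LinearMap.trace ℂ X α = 1 := by
  have h := hg.trace_induced α
  rw [IsCopyable] at hα
  rw [hα, LinearMap.trace_tensorProduct'] at h
  -- Trace preservation gives `t * t = t` for the trace `t`, which is nonzero by positivity.
  exact (mul_eq_right₀ (trace_ne_zero_of_isPositive hpos h0)).1 h

/-- As `g` is injective and `g†` surjective, `g α g†` has the rank `r` of `α`, while `α ⊗ α` has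
rank `r * r`; so `r * r = r`. -/
theorem finrank_range_eq_one_of_isCopyable {α : X →ₗ[ℂ] X} (hα : IsCopyable (induced g) α)
    (h0 : α ≠ 0) : Module.finrank ℂ (LinearMap.range α) = 1 := by
  have hinj : Function.Injective g := Function.LeftInverse.injective hg.special_apply
  have hsurj : LinearMap.range (LinearMap.adjoint g) = ⊤ :=
    LinearMap.range_eq_top.2 (Function.RightInverse.surjective hg.special_apply)
  have h := finrank_range_map α
  rw [IsCopyable] at hα
  rw [← hα, induced_apply, LinearMap.range_comp, LinearMap.range_comp_of_range_eq_top _ hsurj,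
    ← (Submodule.equivMapOfInjective g hinj (LinearMap.range α)).finrank_eq] at h
  refine (mul_eq_right₀ fun hr => h0 ?_).1 h.symm
  rwa [Submodule.finrank_eq_zero, LinearMap.range_eq_bot] at hr

theorem isCopyable_comp {α β : X →ₗ[ℂ] X} (hα : IsCopyable (induced g) α)
    (hβ : IsCopyable (induced g) β) : IsCopyable (induced g) (α ∘ₗ β) := by
  rw [IsCopyable] at *
  rw [← hg.induced_comp_induced, hα, hβ, TensorProduct.map_comp]

theorem isLeast_hasKrausAncilla [Nontrivial X] :
    IsLeast {k : ℕ | HasKrausAncilla (induced g) k} 1 := by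
  refine ⟨hasKrausAncilla_one_induced g, fun k hk => ?_⟩
  rw [Nat.one_le_iff_ne_zero]
  rintro rfl
  have h := hg.dagger_induced_id
  have hz : dagger (0 : (X →ₗ[ℂ] X) →ₗ[ℂ] (X ⊗[ℂ] X →ₗ[ℂ] X ⊗[ℂ] X)) = 0 := by
    simpa using dagger_sum (∅ : Finset Unit)
      (fun _ => (0 : (X →ₗ[ℂ] X) →ₗ[ℂ] (X ⊗[ℂ] X →ₗ[ℂ] X ⊗[ℂ] X)))
  rw [hk.eq_zero, hz] at h
  exact zero_ne_one h

end FdHilb.IsClassicalStructure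

/-- Every classical structure in completely positive maps is canonical, so all the conditions hold
unconditionally, and in particular they are equivalent. -/
theorem mainTheorem1 {X : Type*} [NormedAddCommGroup X] [InnerProductSpace ℂ X]
    [FiniteDimensional ℂ X] [Nontrivial X]
    (δ : (X →ₗ[ℂ] X) →ₗ[ℂ] ((X ⊗[ℂ] X) →ₗ[ℂ] (X ⊗[ℂ] X)))
    (hδ : CPM.IsClassicalStructure δ) :
    List.TFAE [
      -- (a) `δ` is canonical
      CPM.IsCanonical δ,
      -- (b) `δ` preserves pure states
      ∀ ρ : X →ₗ[ℂ] X, CPM.IsPureState ρ → CPM.IsPureState (δ ρ),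
      -- (c) `δ` is trace-preserving
      ∀ ρ : X →ₗ[ℂ] X, LinearMap.trace ℂ (X ⊗[ℂ] X) (δ ρ) = LinearMap.trace ℂ X ρ,
      -- (d) `δ†` is unital
      CPM.dagger δ LinearMap.id = LinearMap.id,
      -- (e) `δ†(id) ≤ id`
      (LinearMap.id - CPM.dagger δ LinearMap.id).IsPositive,
      -- (f) `δ` is trace-nonincreasing (on positive semidefinite operators)
      ∀ ρ : X →ₗ[ℂ] X, ρ.IsPositive →
        (LinearMap.trace ℂ (X ⊗[ℂ] X) (δ ρ)).re ≤ (LinearMap.trace ℂ X ρ).re,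
      -- (g) `δ†(id)` has operator norm at most 1
      ‖LinearMap.toContinuousLinearMap (CPM.dagger δ LinearMap.id)‖ ≤ 1,
      -- (h) the identity is a sum of copyables
      ∃ A : Finset (X →ₗ[ℂ] X), (∀ α ∈ A, CPM.IsCopyable δ α) ∧ ∑ α ∈ A, α = LinearMap.id,
      -- (i) nonzero positive semidefinite copyables have trace 1
      ∀ α : X →ₗ[ℂ] X, CPM.IsCopyable δ α → α ≠ 0 → α.IsPositive → LinearMap.trace ℂ X α = 1,
      -- (j) nonzero copyables have rank 1
      ∀ α : X →ₗ[ℂ] X, CPM.IsCopyable δ α → α ≠ 0 → Module.finrank ℂ (LinearMap.range α) = 1,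
      -- (k) copyables are closed under `α ↦ α† α`
      ∀ α : X →ₗ[ℂ] X, CPM.IsCopyable δ α → CPM.IsCopyable δ (LinearMap.adjoint α ∘ₗ α),
      -- (l) copyables are closed under composition
      ∀ α β : X →ₗ[ℂ] X, CPM.IsCopyable δ α → CPM.IsCopyable δ β → CPM.IsCopyable δ (α ∘ₗ β),
      -- (m) `δ(id)` is idempotent
      δ LinearMap.id ∘ₗ δ LinearMap.id = δ LinearMap.id,
      -- (n) the ancilla of a minimal Kraus decomposition of `δ` is one-dimensional
      IsLeast {k : ℕ | CPM.HasKrausAncilla δ k} 1] := by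
  obtain ⟨g, hg, rfl⟩ := hδ.isCanonical
  -- Each condition is proved outright, hence equivalent to `True`.
  refine List.tfae_of_forall True _ ?_
  simp only [List.forall_mem_cons, iff_true, List.not_mem_nil, false_imp_iff, implies_true,
    and_true]
  refine ⟨⟨g, hg, rfl⟩, fun ρ => hg.isPureState_induced, hg.trace_induced, hg.dagger_induced_id,
    ?_, fun ρ _ => (congrArg Complex.re (hg.trace_induced ρ)).le, ?_,
    hg.exists_sum_copyable_eq_id, fun α => hg.trace_eq_one_of_isCopyable,
    fun α => hg.finrank_range_eq_one_of_isCopyable,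
    fun α hα => hg.isCopyable_comp hα.adjoint hα,
    fun α β => hg.isCopyable_comp, hg.induced_comp_induced _ _, hg.isLeast_hasKrausAncilla⟩
  · rw [hg.dagger_induced_id, sub_self]
    exact LinearMap.isPositive_zero
  · rw [hg.dagger_induced_id]
    exact ContinuousLinearMap.norm_id_le
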